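/- Let $d,m\ge 0$ be integers and let $\Gamma\subset\mathbb{R}^d\times\mathbb{R}^m$ be a lattice (a discrete co-compact subgroup) such that the projection $\pi:\mathbb{R}^d\times\mathbb{R}^m\to\mathbb{R}^d$ is one-to-one on $\Gamma$ and the image of $\Gamma$ under the projection $\pi_H:\mathbb{R}^d\times\mathbb{R}^m\to\mathbb{R}^m$ is dense in $\mathbb{R}^m$. Put $L=\pi(\Gamma)$ and let ${}^*=\pi_H\circ(\pi|_\Gamma)^{-1}:L\to\mathbb{R}^m$. Let $\Omega\subset\mathbb{R}^m$ be relatively compact with non-empty interior and with boundary of Lebesgue measure $0$, and let $\Lambda=t+\{x\in L: x^*\in\Omega\}$ for some $t\in\mathbb{R}^d$ (a regular model set with internal space $\mathbb{R}^m$ and window $\Omega$). For $s>0$ put $\Lambda_s=\{x\in\Lambda:|x|<s\}$. Then all $\Lambda_s$ are finite, and the averaged shelling function $$a(r^2)=\lim_{s\to\infty}\frac{1}{|\Lambda_s|}\sum_{x\in\Lambda_s}\bigl|\{z\in\Lambda: |z-x|=r\}\bigr|$$ exists for every $r\ge 0$. Moreover, for every $r\ge 0$ there are only finitely many $y\in\Lambda-\Lambda$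 with $|y|=r$, and $$a(r^2)=\frac{1}{\mathrm{vol}(\Omega)}\sum_{y\in\Lambda-\Lambda,\ |y|=r}\mathrm{vol}\bigl(\Omega\cap(\Omega-y^*)\bigr).$$ In particular, $a(r^2)=0$ if there is no $y\in\Lambda-\Lambda$ with $y\cdot y=r^2$. -/

import Mathlib

open MeasureTheory Filter Topology
open scoped Pointwise

/-- A cut-and-project scheme with physical space `ℝ^d` and internal space `ℝ^m`: a lattice
(discrete co-compact subgroup) `Γ` of `ℝ^d × ℝ^m` on which the projection to physical space is
one-to-one and whose projection to internal space is dense. -/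
structure CutProjectScheme (d m : ℕ) where
  Γ : AddSubgroup (EuclideanSpace ℝ (Fin d) × EuclideanSpace ℝ (Fin m))
  discrete : DiscreteTopology Γ
  cocompact : CompactSpace ((EuclideanSpace ℝ (Fin d) × EuclideanSpace ℝ (Fin m)) ⧸ Γ)
  injOn_fst : Set.InjOn Prod.fst
    (Γ : Set (EuclideanSpace ℝ (Fin d) × EuclideanSpace ℝ (Fin m)))
  dense_snd : Dense (Prod.snd ''
    (Γ : Set (EuclideanSpace ℝ (Fin d) × EuclideanSpace ℝ (Fin m))))

namespace CutProjectScheme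

variable {d m : ℕ} (S : CutProjectScheme d m)

/-- The projection `L` of the lattice to physical space. -/
def L : AddSubgroup (EuclideanSpace ℝ (Fin d)) :=
  S.Γ.map (AddMonoidHom.fst (EuclideanSpace ℝ (Fin d)) (EuclideanSpace ℝ (Fin m)))

/-- The star map `π_H ∘ (π|_Γ)⁻¹`; its values outside `L` carry no meaning. -/
noncomputable def star (x : EuclideanSpace ℝ (Fin d)) : EuclideanSpace ℝ (Fin m) :=
  (Function.invFunOn Prod.fst
    (S.Γ : Set (EuclideanSpace ℝ (Fin d) × EuclideanSpace ℝ (Fin m))) x).2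

theorem star_eq {x : EuclideanSpace ℝ (Fin d)} {z : EuclideanSpace ℝ (Fin m)}
    (h : (x, z) ∈ S.Γ) : S.star x = z := by
  have h1 : ∃ γ ∈ (S.Γ : Set (EuclideanSpace ℝ (Fin d) × EuclideanSpace ℝ (Fin m))),
      γ.1 = x := ⟨(x, z), h, rfl⟩
  have h2 := S.injOn_fst (Function.invFunOn_mem h1) h (Function.invFunOn_eq h1)
  exact congrArg Prod.snd h2

/-- The set `Λ(Ω) = {x ∈ L | x* ∈ Ω}`. -/
def modelSet (Ω : Set (EuclideanSpace ℝ (Fin m))) : Set (EuclideanSpace ℝ (Fin d)) :=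
  {x | x ∈ S.L ∧ S.star x ∈ Ω}

end CutProjectScheme

/-- The window of a regular model set: relatively compact, with non-empty interior and with
boundary of measure zero. -/
structure IsRegularWindow {m : ℕ} (Ω : Set (EuclideanSpace ℝ (Fin m))) : Prop where
  isCompact_closure : IsCompact (closure Ω)
  nonempty_interior : (interior Ω).Nonempty
  volume_frontier : volume (frontier Ω) = 0

/-- `Λ` is a regular model set obtained from the scheme `S` and the window `Ω`, that is,
`Λ = t + Λ(Ω)` for some translation vector `t`. -/
structure IsRegularModelSet {d m : ℕ} (S : CutProjectScheme d m)
    (Ω : Set (EuclideanSpace ℝ (Fin m))) (Λ : Set (EuclideanSpace ℝ (Fin d))) : Prop where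
  window : IsRegularWindow Ω
  eq_translate : ∃ t : EuclideanSpace ℝ (Fin d), Λ = (fun x => t + x) '' S.modelSet Ω

/-- The points of `Λ` on the shell of squared radius `k` around `x`. -/
def shell {d : ℕ} (Λ : Set (EuclideanSpace ℝ (Fin d))) (x : EuclideanSpace ℝ (Fin d)) (k : ℝ) :
    Set (EuclideanSpace ℝ (Fin d)) :=
  {z | z ∈ Λ ∧ ‖z - x‖ ^ 2 = k}

/-- `Λ_s = {x ∈ Λ | |x| < s}`. -/
def patch {d : ℕ} (Λ : Set (EuclideanSpace ℝ (Fin d))) (s : ℝ) :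
    Set (EuclideanSpace ℝ (Fin d)) :=
  {x | x ∈ Λ ∧ ‖x‖ < s}

/-- The number of points of `Λ` on the shell of squared radius `k`, averaged over all centres
in `Λ_s`. -/
noncomputable def shellMean {d : ℕ} (Λ : Set (EuclideanSpace ℝ (Fin d))) (k s : ℝ) : ℝ :=
  (∑ᶠ x ∈ patch Λ s, ((shell Λ x k).ncard : ℝ)) / ((patch Λ s).ncard : ℝ)

/-- The averaged shelling number of `Λ` for the squared radius `k` exists and equals `a`.
Finiteness of all `Λ_s` makes every count in `shellMean` a count of a finite set. -/
structure HasAveragedShelling {d : ℕ} (Λ : Set (EuclideanSpace ℝ (Fin d))) (k a : ℝ) :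
    Prop where
  finite_patch : ∀ s : ℝ, (patch Λ s).Finite
  tendsto_shellMean : Tendsto (fun s => shellMean Λ k s) atTop (𝓝 a)

/-! Write `z = x + y`. For fixed `r` the differences `y` lie in a finite set independent of `x`:
each lattice point `(y, y*)` lies in a bounded set, since `y*` belongs to `Ω - Ω`. Double counting
turns the sum over centres into a sum over `y` of the number of `x` in `Λ_s` with `x + y ∈ Λ`. As
the star map is additive, these `x` are the patch of the model set with window `Ω ∩ (Ω - y*)`, whose
boundary is again null. Everything thus rests on one fact: patches grow like `c * vol(window) * s ^
d`, with the same `c` for every window. Dividing by the growth of `Λ_s` cancels `c`.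

For that fact, integrate the number of points of `Γ + x` in a set over `x` in a fundamental domain;
the result is the volume of the set. Since `π_H(Γ)` is dense, every such `x` may be shifted by `Γ`
to have arbitrarily small internal part and bounded physical part. This traps the count over `Ω`
between volumes of cylinders over slightly smaller and larger windows, and the null boundary closes
the gap. -/

/-! ### Discrete co-compact subgroups as lattices -/

section Lattice

variable {E : Type*} [NormedAddCommGroup E] [NormedSpace ℝ E] [FiniteDimensional ℝ E]

/-- Otherwise a nonzero linear functional vanishing on `Γ` would descend to an unbounded continuous
function on the compact quotient. -/
theorem AddSubgroup.span_real_eq_top_of_compactSpace_quotient (Γ : AddSubgroup E)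
    [CompactSpace (E ⧸ Γ)] : Submodule.span ℝ (Γ : Set E) = ⊤ := by
  by_contra h
  obtain ⟨f, hf, hker⟩ := Submodule.exists_le_ker_of_lt_top _ (lt_top_iff_ne_top.2 h)
  have hΓ : Γ ≤ f.toAddMonoidHom.ker := fun x hx => hker (Submodule.subset_span hx)
  let F : E ⧸ Γ →+ ℝ := QuotientAddGroup.lift Γ f.toAddMonoidHom hΓ
  have hF : Continuous F :=
    (f.continuous_of_finiteDimensional).quotient_lift _
  have hb := (isCompact_range hF).isBounded
  obtain ⟨C, hC⟩ := hb.exists_norm_le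
  obtain ⟨x, hx⟩ := LinearMap.surjective hf (C + 1)
  have := hC (F (x : E ⧸ Γ)) ⟨_, rfl⟩
  have h2 : F (x : E ⧸ Γ) = C + 1 := hx
  rw [h2, Real.norm_eq_abs] at this
  linarith [le_abs_self (C + 1)]

theorem AddSubgroup.exists_basis_of_compactSpace_quotient (Γ : AddSubgroup E)
    [DiscreteTopology Γ] [CompactSpace (E ⧸ Γ)] :
    ∃ (n : ℕ) (b : Module.Basis (Fin n) ℝ E),
      Γ = (Submodule.span ℤ (Set.range b)).toAddSubgroup := by
  have : DiscreteTopology (AddSubgroup.toIntSubmodule Γ) := ‹DiscreteTopology Γ›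
  have : IsZLattice ℝ (AddSubgroup.toIntSubmodule Γ) :=
    ⟨Γ.span_real_eq_top_of_compactSpace_quotient⟩
  let c := Module.finBasis ℤ (AddSubgroup.toIntSubmodule Γ)
  exact ⟨_, c.ofZLatticeBasis ℝ, by rw [c.ofZLatticeBasis_span ℝ]; rfl⟩

theorem AddSubgroup.finite_inter_of_compactSpace_quotient (Γ : AddSubgroup E)
    [DiscreteTopology Γ] [CompactSpace (E ⧸ Γ)] {s : Set E} (hs : Bornology.IsBounded s) :
    ((Γ : Set E) ∩ s).Finite := by
  obtain ⟨n, b, rfl⟩ := Γ.exists_basis_of_compactSpace_quotient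
  have : ProperSpace E := FiniteDimensional.proper_real E
  rw [Set.inter_comm]
  exact ZSpan.setFinite_inter b hs

theorem AddSubgroup.exists_isBounded_isAddFundamentalDomain (Γ : AddSubgroup E)
    [DiscreteTopology Γ] [CompactSpace (E ⧸ Γ)] [MeasurableSpace E] [BorelSpace E]
    (μ : Measure E) : ∃ D : Set E, Bornology.IsBounded D ∧ MeasurableSet D ∧
      IsAddFundamentalDomain Γ D μ := by
  obtain ⟨n, b, rfl⟩ := Γ.exists_basis_of_compactSpace_quotient
  exact ⟨_, ZSpan.fundamentalDomain_isBounded b, ZSpan.fundamentalDomain_measurableSet b,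
    ZSpan.isAddFundamentalDomain' b μ⟩

theorem AddSubgroup.countable_of_compactSpace_quotient (Γ : AddSubgroup E)
    [DiscreteTopology Γ] [CompactSpace (E ⧸ Γ)] : Countable Γ := by
  obtain ⟨n, b, rfl⟩ := Γ.exists_basis_of_compactSpace_quotient
  have : DiscreteTopology (Submodule.span ℤ (Set.range b)) := inferInstance
  exact inferInstanceAs (Countable (Submodule.span ℤ (Set.range b)))

end Lattice

/-! ### Lattice point counts by integration over a fundamental domain -/

section Counting

variable {E : Type*} [AddCommGroup E]

theorem AddSubgroup.tsum_indicator_eq_ncard (Γ : AddSubgroup E) {A : Set E}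
    (h : ((Γ : Set E) ∩ A).Finite) :
    ∑' g : Γ, A.indicator (1 : E → ENNReal) (g : E) = (((Γ : Set E) ∩ A).ncard : ENNReal) := by
  have h1 := tsum_subtype (Γ : Set E) (A.indicator (1 : E → ENNReal))
  rw [Set.indicator_indicator, ← tsum_subtype] at h1
  refine h1.trans ?_
  have h2 := ENNReal.tsum_set_one ((Γ : Set E) ∩ A)
  rw [← h.cast_ncard_eq] at h2
  exact_mod_cast h2

theorem AddSubgroup.tsum_indicator_le (Γ : AddSubgroup E) {A B : Set E} {x y : E} {g₀ : E}
    (hg₀ : g₀ ∈ Γ) (h : ∀ a : E, a + x ∈ A → a + (y - g₀) ∈ B) :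
    ∑' g : Γ, A.indicator (1 : E → ENNReal) (g + x) ≤
      ∑' g : Γ, B.indicator (1 : E → ENNReal) (g + y) := by
  -- Reindexing by `g ↦ g - g₀` makes the comparison termwise.
  rw [← (Equiv.subRight (⟨g₀, hg₀⟩ : Γ)).tsum_eq
    (fun g : Γ => B.indicator (1 : E → ENNReal) (g + y))]
  refine ENNReal.tsum_le_tsum fun g => ?_
  by_cases hg : (g : E) + x ∈ A
  · have h2 := h g hg
    have h3 : (g : E) + (y - g₀) = ((Equiv.subRight (⟨g₀, hg₀⟩ : Γ)) g : Γ) + y := by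
      simp [Equiv.subRight]; abel
    rw [h3] at h2
    rw [Set.indicator_of_mem hg, Set.indicator_of_mem h2]; simp
  · rw [Set.indicator_of_notMem hg]; exact zero_le

variable [MeasurableSpace E] [MeasurableAdd₂ E] {μ : Measure E} [μ.IsAddLeftInvariant]

theorem MeasureTheory.IsAddFundamentalDomain.lintegral_tsum_indicator {Γ : AddSubgroup E} [Countable Γ]
    {D : Set E} (hD : IsAddFundamentalDomain Γ D μ) {A : Set E} (hA : MeasurableSet A) :
    ∫⁻ x in D, ∑' g : Γ, A.indicator (1 : E → ENNReal) (g + x) ∂μ = μ A := by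
  rw [lintegral_tsum, ← lintegral_indicator_one hA, hD.lintegral_eq_tsum'']
  · rfl
  · intro g
    exact ((measurable_one.indicator hA).comp (measurable_const_add (g : E))).aemeasurable

/-- For each `x ∈ D`, a translation congruent to `x` modulo `Γ` carries `A` into `B`, so `B`
contains at least as many points of `Γ + x` as `A` contains points of `Γ`. Integrate over `D`. -/
theorem MeasureTheory.IsAddFundamentalDomain.ncard_mul_measure_le {Γ : AddSubgroup E} [Countable Γ]
    {D : Set E} (hD : IsAddFundamentalDomain Γ D μ) (hDm : MeasurableSet D) {A B : Set E}
    (hA : ((Γ : Set E) ∩ A).Finite) (hB : MeasurableSet B)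
    (h : ∀ x ∈ D, ∃ g₀ ∈ Γ, ∀ a ∈ A, a + (x - g₀) ∈ B) :
    (((Γ : Set E) ∩ A).ncard : ENNReal) * μ D ≤ μ B := by
  rw [← hD.lintegral_tsum_indicator hB, ← setLIntegral_const]
  refine setLIntegral_mono' hDm fun x hx => ?_
  obtain ⟨g₀, hg₀, hx⟩ := h x hx
  rw [← Γ.tsum_indicator_eq_ncard hA]
  simpa using Γ.tsum_indicator_le (A := A) (B := B) (x := 0) (y := x) hg₀ (by simpa using hx)

theorem MeasureTheory.IsAddFundamentalDomain.measure_le_ncard_mul {Γ : AddSubgroup E} [Countable Γ]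
    {D : Set E} (hD : IsAddFundamentalDomain Γ D μ) (hDm : MeasurableSet D) {A B : Set E}
    (hA : ((Γ : Set E) ∩ A).Finite) (hB : MeasurableSet B)
    (h : ∀ x ∈ D, ∃ g₀ ∈ Γ, ∀ a, a + (x - g₀) ∈ B → a ∈ A) :
    μ B ≤ (((Γ : Set E) ∩ A).ncard : ENNReal) * μ D := by
  rw [← hD.lintegral_tsum_indicator hB, ← setLIntegral_const]
  refine setLIntegral_mono' hDm fun x hx => ?_
  obtain ⟨g₀, hg₀, hx⟩ := h x hx
  rw [← Γ.tsum_indicator_eq_ncard hA]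
  simpa using Γ.tsum_indicator_le (A := B) (B := A) (x := x) (y := 0) (neg_mem hg₀)
    (fun a ha => hx _ (by simpa using ha))

end Counting

/-! ### Small internal shifts from density of the internal projection -/

section CutProject

variable {V W : Type*} [NormedAddCommGroup V] [NormedAddCommGroup W]

/-- By compactness, finitely many `δ`-balls around internal parts of lattice points cover the
internal parts of `D`; finitely many lattice points have bounded physical parts, which gives `C`. -/
theorem AddSubgroup.exists_forall_norm_fst_le_norm_snd_lt (Γ : AddSubgroup (V × W))
    (hΓ : Dense (Prod.snd '' (Γ : Set (V × W)))) [ProperSpace W] {D : Set (V × W)}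
    (hD : Bornology.IsBounded D) {δ : ℝ} (hδ : 0 < δ) :
    ∃ C : ℝ, 0 ≤ C ∧ ∀ x ∈ D, ∃ g ∈ Γ, ‖(x - g).1‖ ≤ C ∧ ‖(x - g).2‖ < δ := by
  obtain ⟨R, hR⟩ := hD.exists_norm_le
  have hK : IsCompact (Metric.closedBall (0 : W) R) := isCompact_closedBall 0 R
  obtain ⟨t, ht⟩ := hK.elim_finite_subcover (fun g : Γ => Metric.ball (g : V × W).2 δ)
    (fun g => Metric.isOpen_ball) (fun w _ => by
      obtain ⟨_, hw, g, hg, rfl⟩ := hΓ.inter_open_nonempty _ Metric.isOpen_ball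
        ⟨w, Metric.mem_ball_self hδ⟩
      exact Set.mem_iUnion.2 ⟨⟨g, hg⟩, Metric.mem_ball_comm.1 hw⟩)
  obtain ⟨M, hM⟩ := (t.image fun g : Γ => ‖(g : V × W).1‖).exists_le
  refine ⟨max 0 (R + M), le_max_left _ _, fun x hx => ?_⟩
  have hx2 : x.2 ∈ Metric.closedBall (0 : W) R := by
    simpa using (norm_snd_le x).trans (hR x hx)
  obtain ⟨g, hg, hxg⟩ := Set.mem_iUnion₂.1 (ht hx2)
  refine ⟨g, g.2, le_max_of_le_right ?_, by simpa [dist_eq_norm] using hxg⟩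
  have h1 := hM _ (Finset.mem_image_of_mem _ hg)
  have h2 := (norm_fst_le x).trans (hR x hx)
  calc ‖(x - g).1‖ ≤ ‖x.1‖ + ‖(g : V × W).1‖ := by simpa using norm_sub_le x.1 (g : V × W).1
    _ ≤ R + M := add_le_add h2 h1

end CutProject

/-! ### Asymptotic counts of lattice points in cylinders -/

section Density

theorem tendsto_add_pow_div_pow_atTop (C : ℝ) (n : ℕ) :
    Tendsto (fun s : ℝ => (s + C) ^ n / s ^ n) atTop (𝓝 1) := by
  have h : Tendsto (fun s : ℝ => (1 + C / s) ^ n) atTop (𝓝 ((1 + 0) ^ n)) :=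
    ((tendsto_const_nhds.div_atTop tendsto_id).const_add 1).pow n
  rw [add_zero, one_pow] at h
  refine h.congr' ?_
  filter_upwards [eventually_gt_atTop 0] with s hs
  rw [← div_pow]
  congr 1
  field_simp

theorem measureReal_prod_ball_prod {V W : Type*} [NormedAddCommGroup V] [NormedSpace ℝ V]
    [FiniteDimensional ℝ V] [MeasurableSpace V] [BorelSpace V] [MeasurableSpace W]
    (μ : Measure V) [μ.IsAddHaarMeasure] (ν : Measure W) [SFinite ν] (p : V) {r : ℝ}
    (hr : 0 < r) (A : Set W) :
    (μ.prod ν).real (Metric.ball p r ×ˢ A) =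
      r ^ Module.finrank ℝ V * μ.real (Metric.ball 0 1) * ν.real A := by
  rw [measureReal_prod_prod, Measure.real, Measure.addHaar_ball_of_pos μ p hr, ENNReal.toReal_mul,
    ENNReal.toReal_ofReal (by positivity)]
  rfl

variable {V W : Type*} [NormedAddCommGroup V] [NormedSpace ℝ V] [FiniteDimensional ℝ V]
  [MeasurableSpace V] [BorelSpace V] [NormedAddCommGroup W] [NormedSpace ℝ W]
  [FiniteDimensional ℝ W] [MeasurableSpace W] [BorelSpace W]
  {μ : Measure V} [μ.IsAddHaarMeasure] {ν : Measure W} [ν.IsAddHaarMeasure]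

theorem ncard_lattice_inter_ball_prod_mul_le {Γ : AddSubgroup (V × W)}
    [DiscreteTopology Γ] [CompactSpace ((V × W) ⧸ Γ)]
    (hΓ : Dense (Prod.snd '' (Γ : Set (V × W)))) {D : Set (V × W)}
    (hb : Bornology.IsBounded D) (hDm : MeasurableSet D)
    (hD : IsAddFundamentalDomain Γ D (μ.prod ν)) {Ω U : Set W} (hΩ : IsCompact (closure Ω))
    (hU : IsOpen U) (hΩU : closure Ω ⊆ U) (hνU : ν U ≠ ⊤) :
    ∃ C : ℝ, ∀ (p : V) (s : ℝ), 0 < s →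
      (((Γ : Set (V × W)) ∩ Metric.ball p s ×ˢ Ω).ncard : ℝ) * (μ.prod ν).real D ≤
        (s + C) ^ Module.finrank ℝ V * μ.real (Metric.ball 0 1) * ν.real U := by
  have : ProperSpace V := FiniteDimensional.proper_real V
  have : ProperSpace W := FiniteDimensional.proper_real W
  have := Γ.countable_of_compactSpace_quotient
  obtain ⟨δ, hδ, hδU⟩ := hΩ.exists_thickening_subset_open hU hΩU
  obtain ⟨C, hC, h⟩ := Γ.exists_forall_norm_fst_le_norm_snd_lt hΓ hb hδ
  refine ⟨C, fun p s hs => ?_⟩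
  rw [← measureReal_prod_ball_prod μ ν p (by positivity)]
  have hfin := Γ.finite_inter_of_compactSpace_quotient
    (Metric.isBounded_ball (x := p) (r := s) |>.prod (hΩ.isBounded.subset subset_closure))
  have key := hD.ncard_mul_measure_le hDm (B := Metric.ball p (s + C) ×ˢ U) hfin
    (measurableSet_ball.prod hU.measurableSet) (fun x hx => by
      obtain ⟨g, hg, h1, h2⟩ := h x hx
      refine ⟨g, hg, fun a ha => ⟨?_, hδU ?_⟩⟩
      · have := ha.1
        rw [Metric.mem_ball, dist_eq_norm] at this ⊢
        calc ‖(a + (x - g)).1 - p‖ = ‖(a.1 - p) + (x - g).1‖ := by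
              congr 1; simp only [Prod.fst_add]; abel
          _ ≤ ‖a.1 - p‖ + ‖(x - g).1‖ := norm_add_le _ _
          _ < s + C := add_lt_add_of_lt_of_le this h1
      · refine Metric.mem_thickening_iff.2 ⟨a.2, subset_closure ha.2, ?_⟩
        simpa [dist_eq_norm] using h2)
  have hfin2 : (μ.prod ν) (Metric.ball p (s + C) ×ˢ U) ≠ ⊤ := by
    rw [Measure.prod_prod]
    exact ENNReal.mul_ne_top measure_ball_lt_top.ne hνU
  have := ENNReal.toReal_mono hfin2 key
  rwa [ENNReal.toReal_mul, ENNReal.toReal_natCast] at this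

theorem le_ncard_lattice_inter_ball_prod_mul {Γ : AddSubgroup (V × W)}
    [DiscreteTopology Γ] [CompactSpace ((V × W) ⧸ Γ)]
    (hΓ : Dense (Prod.snd '' (Γ : Set (V × W)))) {D : Set (V × W)}
    (hb : Bornology.IsBounded D) (hDm : MeasurableSet D)
    (hD : IsAddFundamentalDomain Γ D (μ.prod ν)) {Ω K : Set W}
    (hΩ : IsCompact (closure Ω)) (hK : IsCompact K) (hKΩ : K ⊆ interior Ω) :
    ∃ C : ℝ, ∀ (p : V) (s : ℝ), C < s →
      (s - C) ^ Module.finrank ℝ V * μ.real (Metric.ball 0 1) * ν.real K ≤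
        (((Γ : Set (V × W)) ∩ Metric.ball p s ×ˢ Ω).ncard : ℝ) * (μ.prod ν).real D := by
  have : ProperSpace V := FiniteDimensional.proper_real V
  have : ProperSpace W := FiniteDimensional.proper_real W
  have := Γ.countable_of_compactSpace_quotient
  obtain ⟨δ, hδ, hδK⟩ := hK.exists_thickening_subset_open isOpen_interior hKΩ
  obtain ⟨C, hC, h⟩ := Γ.exists_forall_norm_fst_le_norm_snd_lt hΓ hb hδ
  refine ⟨C, fun p s hs => ?_⟩
  rw [← measureReal_prod_ball_prod μ ν p (sub_pos.2 hs)]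
  have hfin := Γ.finite_inter_of_compactSpace_quotient
    (Metric.isBounded_ball (x := p) (r := s) |>.prod (hΩ.isBounded.subset subset_closure))
  have key := hD.measure_le_ncard_mul hDm (B := Metric.ball p (s - C) ×ˢ K) hfin
    (measurableSet_ball.prod hK.isClosed.measurableSet) (fun x hx => by
      obtain ⟨g, hg, h1, h2⟩ := h x hx
      refine ⟨g, hg, fun a ha => ⟨?_, interior_subset (hδK ?_)⟩⟩
      · have := ha.1
        rw [Metric.mem_ball, dist_eq_norm] at this ⊢
        calc ‖a.1 - p‖ = ‖((a + (x - g)).1 - p) - (x - g).1‖ := by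
              congr 1; simp only [Prod.fst_add]; abel
          _ ≤ ‖(a + (x - g)).1 - p‖ + ‖(x - g).1‖ := norm_sub_le _ _
          _ < (s - C) + C := add_lt_add_of_lt_of_le this h1
          _ = s := by ring
      · refine Metric.mem_thickening_iff.2 ⟨_, ha.2, ?_⟩
        rw [dist_comm]
        simpa [dist_eq_norm] using h2)
  have hfin2 : (((Γ : Set (V × W)) ∩ Metric.ball p s ×ˢ Ω).ncard : ENNReal) * (μ.prod ν) D ≠ ⊤ :=
    ENNReal.mul_ne_top (ENNReal.natCast_ne_top _) hb.measure_lt_top.ne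
  have := ENNReal.toReal_mono hfin2 key
  rwa [ENNReal.toReal_mul, ENNReal.toReal_natCast] at this

variable (ν) in
/-- Points of a lattice in a cylinder over a Jordan measurable window are uniformly
distributed. -/
theorem exists_tendsto_ncard_lattice_inter_ball_prod (Γ : AddSubgroup (V × W))
    [DiscreteTopology Γ] [CompactSpace ((V × W) ⧸ Γ)]
    (hΓ : Dense (Prod.snd '' (Γ : Set (V × W)))) :
    ∃ c : ℝ, 0 < c ∧ ∀ (p : V) (Ω : Set W), IsCompact (closure Ω) → ν (frontier Ω) = 0 →
      Tendsto (fun s : ℝ => (((Γ : Set (V × W)) ∩ Metric.ball p s ×ˢ Ω).ncard : ℝ) /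
        s ^ Module.finrank ℝ V) atTop (𝓝 (c * ν.real Ω)) := by
  have : ProperSpace V := FiniteDimensional.proper_real V
  have : ProperSpace W := FiniteDimensional.proper_real W
  have := Γ.countable_of_compactSpace_quotient
  let μ : Measure V := Measure.addHaar
  obtain ⟨D, hb, hDm, hD⟩ := Γ.exists_isBounded_isAddFundamentalDomain (μ.prod ν)
  have hDpos : 0 < (μ.prod ν).real D :=
    ENNReal.toReal_pos (hD.measure_ne_zero (NeZero.ne _)) hb.measure_lt_top.ne
  have hBpos : 0 < μ.real (Metric.ball (0 : V) 1) :=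
    ENNReal.toReal_pos (Metric.measure_ball_pos μ 0 one_pos).ne' measure_ball_lt_top.ne
  -- Unit ball volume over covolume; the window does not enter.
  set c := μ.real (Metric.ball (0 : V) 1) / (μ.prod ν).real D with hc
  have hcpos : 0 < c := div_pos hBpos hDpos
  refine ⟨c, hcpos, fun p Ω hΩ hfr => ?_⟩
  have hcl : ν (closure Ω) = ν Ω :=
    measure_congr (closure_ae_eq_of_null_frontier hfr)
  have hint : ν (interior Ω) = ν Ω :=
    measure_congr (interior_ae_eq_of_null_frontier hfr)
  have hfin : ν Ω ≠ ⊤ := hcl ▸ hΩ.measure_lt_top.ne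
  rw [tendsto_order]
  constructor
  · intro b hb'
    obtain ⟨ε, hε, hbε⟩ : ∃ ε : ℝ, 0 < ε ∧ b = c * (ν.real Ω - ε) :=
      -- `ε` is the loss of window volume that lowers the limit exactly to `b`.
      ⟨(c * ν.real Ω - b) / c, div_pos (by linarith) hcpos, by field_simp; ring⟩
    obtain ⟨K, hK, hKc, hlt⟩ := (isOpen_interior (s := Ω)).measurableSet.exists_isCompact_lt_add
      (μ := ν) (hint ▸ hfin) (ε := ENNReal.ofReal ε) (by simpa using hε)
    have hlt' : ν.real Ω < ν.real K + ε := by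
      rw [hint, ← ENNReal.toReal_lt_toReal hfin
        (ENNReal.add_ne_top.2 ⟨hKc.measure_lt_top.ne, ENNReal.ofReal_ne_top⟩),
        ENNReal.toReal_add hKc.measure_lt_top.ne ENNReal.ofReal_ne_top,
        ENNReal.toReal_ofReal hε.le] at hlt
      exact hlt
    obtain ⟨C, hC⟩ := le_ncard_lattice_inter_ball_prod_mul (μ := μ) (ν := ν) hΓ hb hDm hD hΩ hKc hK
    have hlim := (tendsto_add_pow_div_pow_atTop (-C) (Module.finrank ℝ V)).mul_const
      (c * ν.real K)
    have hlt2 : b < 1 * (c * ν.real K) := by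
      rw [one_mul, hbε]; exact mul_lt_mul_of_pos_left (by linarith) hcpos
    filter_upwards [hlim.eventually (lt_mem_nhds hlt2), eventually_gt_atTop 0,
      eventually_gt_atTop C] with s h1 h2 h3
    refine h1.trans_le ?_
    rw [div_mul_eq_mul_div, ← sub_eq_add_neg]
    gcongr
    have := hC p s h3
    rw [hc, div_mul_eq_mul_div, mul_div_assoc', div_le_iff₀ hDpos, ← mul_assoc]
    exact this
  · intro b hb'
    obtain ⟨ε, hε, hbε⟩ : ∃ ε : ℝ, 0 < ε ∧ b = c * (ν.real Ω + ε) :=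
      ⟨(b - c * ν.real Ω) / c, div_pos (by linarith) hcpos, by field_simp; ring⟩
    -- Outer regularity is applied to the closure, which has the measure of `Ω` because the frontier
    -- is null.
    obtain ⟨U, hU, hUo, hlt⟩ := (closure Ω).exists_isOpen_lt_add
      (μ := ν) (hcl ▸ hfin) (ε := ENNReal.ofReal ε) (by simpa using hε)
    have hUtop : ν U ≠ ⊤ := hlt.ne_top
    have hlt' : ν.real U < ν.real Ω + ε := by
      rw [hcl, ← ENNReal.toReal_lt_toReal hUtop
        (ENNReal.add_ne_top.2 ⟨hfin, ENNReal.ofReal_ne_top⟩),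
        ENNReal.toReal_add hfin ENNReal.ofReal_ne_top,
        ENNReal.toReal_ofReal hε.le] at hlt
      exact hlt
    obtain ⟨C, hC⟩ := ncard_lattice_inter_ball_prod_mul_le (μ := μ) (ν := ν) hΓ hb hDm hD hΩ hUo hU hUtop
    have hlim := (tendsto_add_pow_div_pow_atTop C (Module.finrank ℝ V)).mul_const
      (c * ν.real U)
    have hlt2 : 1 * (c * ν.real U) < b := by
      rw [one_mul, hbε]; exact mul_lt_mul_of_pos_left (by linarith) hcpos
    filter_upwards [hlim.eventually (gt_mem_nhds hlt2), eventually_gt_atTop 0] with s h1 h2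
    refine lt_of_le_of_lt ?_ h1
    rw [div_mul_eq_mul_div]
    gcongr
    have := hC p s h2
    rw [hc, div_mul_eq_mul_div, mul_div_assoc', le_div_iff₀ hDpos, ← mul_assoc]
    exact this

end Density

/-! ### Model sets, their densities and difference sets -/

namespace CutProjectScheme

variable {d m : ℕ} (S : CutProjectScheme d m)

theorem mem_L_iff {x : EuclideanSpace ℝ (Fin d)} : x ∈ S.L ↔ (x, S.star x) ∈ S.Γ := by
  constructor
  · rintro ⟨⟨x, z⟩, h, rfl⟩
    have h' : (x, z) ∈ S.Γ := h
    change (x, S.star x) ∈ S.Γ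
    rwa [S.star_eq h']
  · intro h
    exact ⟨_, h, rfl⟩

theorem star_add {x y : EuclideanSpace ℝ (Fin d)} (hx : x ∈ S.L) (hy : y ∈ S.L) :
    S.star (x + y) = S.star x + S.star y :=
  S.star_eq (S.Γ.add_mem (S.mem_L_iff.1 hx) (S.mem_L_iff.1 hy))

theorem star_sub {x y : EuclideanSpace ℝ (Fin d)} (hx : x ∈ S.L) (hy : y ∈ S.L) :
    S.star (x - y) = S.star x - S.star y :=
  S.star_eq (S.Γ.sub_mem (S.mem_L_iff.1 hx) (S.mem_L_iff.1 hy))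

theorem finite_inter {s : Set (EuclideanSpace ℝ (Fin d) × EuclideanSpace ℝ (Fin m))}
    (hs : Bornology.IsBounded s) :
    ((S.Γ : Set (EuclideanSpace ℝ (Fin d) × EuclideanSpace ℝ (Fin m))) ∩ s).Finite := by
  have := S.discrete
  have := S.cocompact
  exact S.Γ.finite_inter_of_compactSpace_quotient hs

theorem patch_translate_modelSet (Ω : Set (EuclideanSpace ℝ (Fin m)))
    (t : EuclideanSpace ℝ (Fin d)) (s : ℝ) :
    patch ((fun x => t + x) '' S.modelSet Ω) s = (fun γ => t + γ.1) ''
      ((S.Γ : Set (EuclideanSpace ℝ (Fin d) × EuclideanSpace ℝ (Fin m))) ∩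
        Metric.ball (-t) s ×ˢ Ω) := by
  ext x
  constructor
  · rintro ⟨⟨x, ⟨hx, hΩ⟩, rfl⟩, hs⟩
    refine ⟨(x, S.star x), ⟨S.mem_L_iff.1 hx, ?_, hΩ⟩, rfl⟩
    simpa [Metric.mem_ball, dist_eq_norm, add_comm] using hs
  · rintro ⟨⟨x, z⟩, ⟨h, hs, hΩ⟩, rfl⟩
    have h' : (x, z) ∈ S.Γ := h
    refine ⟨⟨x, ⟨⟨_, h, rfl⟩, ?_⟩, rfl⟩, ?_⟩
    · rwa [S.star_eq h']
    · simpa [Metric.mem_ball, dist_eq_norm, add_comm] using hs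

theorem finite_patch_translate_modelSet {Ω : Set (EuclideanSpace ℝ (Fin m))}
    (hΩ : Bornology.IsBounded Ω) (t : EuclideanSpace ℝ (Fin d)) (s : ℝ) :
    (patch ((fun x => t + x) '' S.modelSet Ω) s).Finite := by
  rw [patch_translate_modelSet]
  exact (S.finite_inter (Metric.isBounded_ball.prod hΩ)).image _

theorem ncard_patch_translate_modelSet (Ω : Set (EuclideanSpace ℝ (Fin m)))
    (t : EuclideanSpace ℝ (Fin d)) (s : ℝ) :
    (patch ((fun x => t + x) '' S.modelSet Ω) s).ncard =
      ((S.Γ : Set (EuclideanSpace ℝ (Fin d) × EuclideanSpace ℝ (Fin m))) ∩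
        Metric.ball (-t) s ×ˢ Ω).ncard := by
  rw [patch_translate_modelSet]
  refine Set.InjOn.ncard_image fun γ hγ γ' hγ' h => ?_
  exact S.injOn_fst hγ.1 hγ'.1 (add_left_cancel h)

/-- Model sets have uniform densities, proportional to the volume of the window. -/
theorem exists_tendsto_ncard_patch :
    ∃ c : ℝ, 0 < c ∧ ∀ (t : EuclideanSpace ℝ (Fin d)) (Ω : Set (EuclideanSpace ℝ (Fin m))),
      IsCompact (closure Ω) → volume (frontier Ω) = 0 →
      Tendsto (fun s : ℝ => ((patch ((fun x => t + x) '' S.modelSet Ω) s).ncard : ℝ) / s ^ d)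
        atTop (𝓝 (c * (volume Ω).toReal)) := by
  have := S.discrete
  have := S.cocompact
  obtain ⟨c, hc, h⟩ := exists_tendsto_ncard_lattice_inter_ball_prod volume S.Γ S.dense_snd
  refine ⟨c, hc, fun t Ω hΩ hfr => ?_⟩
  simp_rw [ncard_patch_translate_modelSet]
  have := h (-t) Ω hΩ hfr
  rwa [finrank_euclideanSpace_fin] at this

theorem sub_translate_modelSet_subset_L (Ω : Set (EuclideanSpace ℝ (Fin m)))
    (t : EuclideanSpace ℝ (Fin d)) {y : EuclideanSpace ℝ (Fin d)}
    (hy : y ∈ (fun x => t + x) '' S.modelSet Ω - (fun x => t + x) '' S.modelSet Ω) :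
    y ∈ S.L ∧ S.star y ∈ Ω - Ω := by
  obtain ⟨_, ⟨a, ha, rfl⟩, _, ⟨b, hb, rfl⟩, rfl⟩ := hy
  simp only [add_sub_add_left_eq_sub]
  refine ⟨S.L.sub_mem ha.1 hb.1, ?_⟩
  rw [S.star_sub ha.1 hb.1]
  exact Set.sub_mem_sub ha.2 hb.2

theorem finite_sub_norm_eq {Ω : Set (EuclideanSpace ℝ (Fin m))}
    (hΩ : Bornology.IsBounded Ω) (t : EuclideanSpace ℝ (Fin d)) (r : ℝ) :
    {y | y ∈ (fun x => t + x) '' S.modelSet Ω - (fun x => t + x) '' S.modelSet Ω ∧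
      ‖y‖ = r}.Finite := by
  refine ((S.finite_inter ((Metric.isBounded_closedBall (x := 0) (r := r)).prod
    (hΩ.sub hΩ))).image Prod.fst).subset ?_
  rintro y ⟨hy, hr⟩
  obtain ⟨hL, hs⟩ := S.sub_translate_modelSet_subset_L Ω t hy
  exact ⟨(y, S.star y), ⟨S.mem_L_iff.1 hL, by simp [hr], hs⟩, rfl⟩

theorem mem_translate_modelSet_and_add_mem_iff (Ω : Set (EuclideanSpace ℝ (Fin m)))
    (t : EuclideanSpace ℝ (Fin d)) {x y : EuclideanSpace ℝ (Fin d)} (hy : y ∈ S.L) :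
    (x ∈ (fun x => t + x) '' S.modelSet Ω ∧ x + y ∈ (fun x => t + x) '' S.modelSet Ω) ↔
      x ∈ (fun x => t + x) '' S.modelSet (Ω ∩ (fun z => z - S.star y) '' Ω) := by
  constructor
  · rintro ⟨⟨x, hx, rfl⟩, ⟨x', hx', h⟩⟩
    have h' : x' = x + y := by
      simpa [add_assoc] using h
    subst h'
    refine ⟨x, ⟨hx.1, hx.2, _, hx'.2, ?_⟩, rfl⟩
    simp [S.star_add hx.1 hy]
  · rintro ⟨x, ⟨hx, hΩ, z, hz, hzx⟩, rfl⟩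
    refine ⟨⟨x, ⟨hx, hΩ⟩, rfl⟩, x + y, ⟨S.L.add_mem hx hy, ?_⟩, by simp [add_assoc]⟩
    rw [S.star_add hx hy, ← hzx]
    simpa using hz

end CutProjectScheme

/-! ### Averaging over shells -/

/-- Both sides count the pairs `(x, y)` with `x` in the patch, `y` a difference of norm `r` and `x +
y ∈ Λ`. -/
theorem finsum_ncard_shell_eq {d : ℕ} (Λ : Set (EuclideanSpace ℝ (Fin d))) {r s : ℝ} (hr : 0 ≤ r)
    (hP : (patch Λ s).Finite) (hY : {y | y ∈ Λ - Λ ∧ ‖y‖ = r}.Finite) :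
    ∑ᶠ x ∈ patch Λ s, ((shell Λ x (r ^ 2)).ncard : ℝ) =
      ∑ y ∈ hY.toFinset, ({x | x ∈ patch Λ s ∧ x + y ∈ Λ}.ncard : ℝ) := by
  classical
  rw [finsum_mem_eq_finite_toFinset_sum _ hP]
  have h1 : ∀ x ∈ hP.toFinset, ((shell Λ x (r ^ 2)).ncard : ℝ) =
      ((hY.toFinset.bipartiteAbove (fun x y => x + y ∈ Λ) x).card : ℝ) := by
    intro x hx
    have hx : x ∈ patch Λ s := hP.mem_toFinset.1 hx
    have : shell Λ x (r ^ 2) =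
        (fun y => x + y) '' (hY.toFinset.bipartiteAbove (fun x y => x + y ∈ Λ) x : Set _) := by
      ext z
      simp only [Finset.coe_bipartiteAbove, Set.Finite.mem_toFinset, Set.mem_image, shell,
        Set.mem_ofPred_eq, pow_left_inj₀ (norm_nonneg _) hr two_ne_zero]
      constructor
      · rintro ⟨hz, hzr⟩
        exact ⟨z - x, ⟨⟨Set.sub_mem_sub hz hx.1, hzr⟩, by simpa using hz⟩, by simp⟩
      · rintro ⟨y, ⟨⟨_, hy⟩, hxy⟩, rfl⟩
        exact ⟨hxy, by simpa using hy⟩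
    rw [this, Set.ncard_image_of_injective _ (add_right_injective x), Set.ncard_coe_finset]
  have h2 : ∀ y ∈ hY.toFinset, ({x | x ∈ patch Λ s ∧ x + y ∈ Λ}.ncard : ℝ) =
      ((hP.toFinset.bipartiteBelow (fun x y => x + y ∈ Λ) y).card : ℝ) := by
    intro y _
    rw [← Set.ncard_coe_finset]
    congr 2
    ext x
    simp
  rw [Finset.sum_congr rfl h1, Finset.sum_congr rfl h2]
  exact_mod_cast Finset.sum_card_bipartiteAbove_eq_sum_card_bipartiteBelow _

namespace IsRegularWindow

variable {m : ℕ} {Ω : Set (EuclideanSpace ℝ (Fin m))}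

theorem volume_toReal_pos (h : IsRegularWindow Ω) : 0 < (volume Ω).toReal :=
  ENNReal.toReal_pos
    ((isOpen_interior.measure_pos _ h.nonempty_interior).trans_le
      (measure_mono interior_subset)).ne'
    ((measure_mono subset_closure).trans_lt h.isCompact_closure.measure_lt_top).ne

theorem isCompact_closure_inter (h : IsRegularWindow Ω) (Ω' : Set (EuclideanSpace ℝ (Fin m))) :
    IsCompact (closure (Ω ∩ Ω')) :=
  h.isCompact_closure.of_isClosed_subset isClosed_closure (closure_mono Set.inter_subset_left)

theorem volume_frontier_inter_translate (h : IsRegularWindow Ω) (v : EuclideanSpace ℝ (Fin m)) :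
    volume (frontier (Ω ∩ (fun z => z - v) '' Ω)) = 0 := by
  have h1 : volume (frontier ((fun z => z - v) '' Ω)) = 0 := by
    have : frontier ((fun z => z - v) '' Ω) = (fun z => z - v) '' frontier Ω :=
      ((Homeomorph.subRight v).image_frontier Ω).symm
    rw [this]
    simpa [sub_eq_add_neg] using h.volume_frontier
  refine measure_mono_null (frontier_inter_subset _ _) (measure_union_null ?_ ?_)
  · exact measure_mono_null Set.inter_subset_left h.volume_frontier
  · exact measure_mono_null Set.inter_subset_right h1

end IsRegularWindow

theorem IsRegularModelSet.tendsto_shellMean {d m : ℕ} {S : CutProjectScheme d m}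
    {Ω : Set (EuclideanSpace ℝ (Fin m))} {Λ : Set (EuclideanSpace ℝ (Fin d))}
    (hΛ : IsRegularModelSet S Ω Λ) {r : ℝ} (hr : 0 ≤ r) :
    Tendsto (fun s => shellMean Λ (r ^ 2) s) atTop (𝓝 (1 / (volume Ω).toReal *
      ∑ᶠ y ∈ {y | y ∈ Λ - Λ ∧ ‖y‖ = r},
        (volume (Ω ∩ (fun z => z - S.star y) '' Ω)).toReal)) := by
  obtain ⟨t, rfl⟩ := hΛ.eq_translate
  have hW := hΛ.window
  have hb : Bornology.IsBounded Ω := hW.isCompact_closure.isBounded.subset subset_closure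
  set Λ := (fun x => t + x) '' S.modelSet Ω with hΛdef
  have hY : {y | y ∈ Λ - Λ ∧ ‖y‖ = r}.Finite := S.finite_sub_norm_eq hb t r
  obtain ⟨c, hc, hlim⟩ := S.exists_tendsto_ncard_patch
  rw [finsum_mem_eq_finite_toFinset_sum _ hY]
  have hnum : Tendsto (fun s : ℝ => ∑ y ∈ hY.toFinset,
      ((patch ((fun x => t + x) '' S.modelSet (Ω ∩ (fun z => z - S.star y) '' Ω)) s).ncard : ℝ) /
        s ^ d) atTop (𝓝 (∑ y ∈ hY.toFinset,
          c * (volume (Ω ∩ (fun z => z - S.star y) '' Ω)).toReal)) :=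
    tendsto_finsetSum _ fun y _ => hlim t _ (hW.isCompact_closure_inter _)
      (hW.volume_frontier_inter_translate _)
  have hden := hlim t Ω hW.isCompact_closure hW.volume_frontier
  have hpos := hW.volume_toReal_pos
  have hquot := hnum.div hden (mul_pos hc hpos).ne'
  rw [← Finset.mul_sum, mul_div_mul_left _ _ hc.ne'] at hquot
  rw [one_div_mul_eq_div]
  refine hquot.congr' ?_
  filter_upwards [eventually_gt_atTop 0] with s hs
  rw [Pi.div_apply, ← Finset.sum_div, div_div_div_cancel_right₀ (pow_pos hs d).ne', shellMean,
    finsum_ncard_shell_eq Λ hr (S.finite_patch_translate_modelSet hb t s) hY]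
  congr 1
  refine Finset.sum_congr rfl fun y hy => ?_
  have hyL := (S.sub_translate_modelSet_subset_L Ω t (hY.mem_toFinset.1 hy).1).1
  congr 2
  ext x
  have := S.mem_translate_modelSet_and_add_mem_iff Ω t (x := x) hyL
  simp only [patch, Set.mem_ofPred_eq, ← this, ← hΛdef]
  tauto

theorem theorem2 (d m : ℕ) (S : CutProjectScheme d m)
    (Ω : Set (EuclideanSpace ℝ (Fin m))) (Λ : Set (EuclideanSpace ℝ (Fin d)))
    (hΛ : IsRegularModelSet S Ω Λ) :
    ∃ a : ℝ → ℝ,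
      (∀ r : ℝ, 0 ≤ r → HasAveragedShelling Λ (r ^ 2) (a (r ^ 2))) ∧
      (∀ r : ℝ, 0 ≤ r →
        {y | y ∈ Λ - Λ ∧ ‖y‖ = r}.Finite ∧
        a (r ^ 2) = 1 / (volume Ω).toReal *
          ∑ᶠ y ∈ {y | y ∈ Λ - Λ ∧ ‖y‖ = r},
            (volume (Ω ∩ (fun z => z - S.star y) '' Ω)).toReal) ∧
      (∀ r : ℝ, 0 ≤ r → (¬ ∃ y ∈ Λ - Λ, inner ℝ y y = r ^ 2) → a (r ^ 2) = 0) := by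
  have hb : Bornology.IsBounded Ω :=
    hΛ.window.isCompact_closure.isBounded.subset subset_closure
  obtain ⟨t, ht⟩ := hΛ.eq_translate
  -- The argument of `a` is the squared radius, hence `√k`.
  refine ⟨fun k => 1 / (volume Ω).toReal * ∑ᶠ y ∈ {y | y ∈ Λ - Λ ∧ ‖y‖ = √k},
    (volume (Ω ∩ (fun z => z - S.star y) '' Ω)).toReal, fun r hr => ?_, fun r hr => ?_,
    fun r hr h => ?_⟩
  · simp only [Real.sqrt_sq hr]
    exact ⟨fun s => ht ▸ S.finite_patch_translate_modelSet hb t s, hΛ.tendsto_shellMean hr⟩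
  · simp only [Real.sqrt_sq hr, and_true]
    exact ht ▸ S.finite_sub_norm_eq hb t r
  · have hempty : {y | y ∈ Λ - Λ ∧ ‖y‖ = r} = ∅ := by
      refine Set.eq_empty_of_forall_notMem fun y hy => h ⟨y, hy.1, ?_⟩
      rw [real_inner_self_eq_norm_sq, hy.2]
    simp only [Real.sqrt_sq hr, hempty, Set.mem_empty_iff_false, finsum_false, finsum_zero,
      mul_zero]
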